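/- Let $X$ be a standard Borel space and $\mu$ a probability measure on $X$ with no atoms (a standard non-atomic probability space). Let $\mathcal T$ be the set of all measurable maps $T:X\to X$ with $\mu(T^{-1}(A))=\mu(A)$ for every measurable $A\subseteq X$, where two maps that agree $\mu$-almost everywhere are identified. Each $T\in\mathcal T$ has its Koopman operator $f\mapsto f\circ T$, an isometry of $L^2(X,\mu)=L^2(X,\mu;\mathbb C)$. Give $\mathcal T$ the strong operator topology of the Koopman operators (the coarsest topology for which $T\mapsto f\circ T\in L^2(X,\mu)$ is norm continuous for every $f\in L^2(X,\mu)$). Let $\mathcal T_{\mathrm{inv}}\subseteq\mathcal T$ be the set of (essentially) invertible transformations, that is, of those $T$ for which there is $S\in\mathcal T$ with $S\circ T=T\circ S=\mathrm{id}$ $\mu$-almost everywhere. Call a subset of a topological space residual if its complement is contained in a countable union of nowhere dense sets, and call a property generic in a space if the set of points having it is residual. Then: 1. The strong operator topology on $\mathcal T$ coincides with the weak operator topology of the Koopman operators. 2. $\mathcal T_{\mathrm{inv}}$ is a residual subset of $\mathcal T$: it is dense in $\mathcal T$, and $\mathcal T\setminus\mathcal T_{\mathrm{inv}}$ is a countable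 union of nowhere dense subsets of $\mathcal T$. 3. The subspace topology on $\mathcal T_{\mathrm{inv}}$ coincides with the strong$^*$ operator topology (strong convergence of the Koopman operators and of their adjoints), and every property of transformations that is generic in $\mathcal T_{\mathrm{inv}}$ with this topology is also generic in $\mathcal T$. -/

import Mathlib

open MeasureTheory Topology
open scoped ENNReal

noncomputable section

/-- The Hilbert space `L²(X, μ)` of complex-valued functions. -/
abbrev L2 {X : Type*} [MeasurableSpace X] (μ : Measure X) : Type _ := Lp ℂ 2 μ

/-- Two measure-preserving maps `X → X` are identified if they agree almost everywhere. -/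
def transformationSetoid {X : Type*} [MeasurableSpace X] (μ : Measure X) :
    Setoid {f : X → X // MeasurePreserving f μ μ} where
  r f g := f.1 =ᵐ[μ] g.1
  iseqv := ⟨fun _ => Filter.EventuallyEq.rfl, fun h => h.symm, fun h₁ h₂ => h₁.trans h₂⟩

/-- The set `𝒯` of all measure-preserving transformations of `(X, μ)`, modulo almost everywhere
equality. -/
def Transformation {X : Type*} [MeasurableSpace X] (μ : Measure X) : Type _ :=
  Quotient (transformationSetoid μ)

namespace Transformation

variable {X : Type*} [MeasurableSpace X] {μ : Measure X}

/-- The class of a measure-preserving map. -/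
def mk (f : X → X) (hf : MeasurePreserving f μ μ) : Transformation μ :=
  Quotient.mk (transformationSetoid μ) ⟨f, hf⟩

/-- The Koopman operator `g ↦ g ∘ T` on `L²(X, μ)`. -/
def koopman (T : Transformation μ) : L2 μ →L[ℂ] L2 μ :=
  Quotient.lift
    (fun f : {f : X → X // MeasurePreserving f μ μ} =>
      (Lp.compMeasurePreservingₗᵢ ℂ f.1 f.2 : L2 μ →ₗᵢ[ℂ] L2 μ).toContinuousLinearMap)
    (fun f₁ f₂ h => by
      ext1 g
      exact Subtype.ext (AEEqFun.compMeasurePreserving_congr g.1 f₁.2 f₂.2.measurable h)) T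

theorem koopman_mk_apply (f : X → X) (hf : MeasurePreserving f μ μ) (g : L2 μ) :
    koopman (mk f hf) g = Lp.compMeasurePreserving f hf g := rfl

/-- The strong operator topology of the Koopman operators (pointwise norm convergence on
`L²(X, μ)`); it is the default topology on `𝒯`. -/
instance strongTopology : TopologicalSpace (Transformation μ) :=
  TopologicalSpace.induced (fun T => (T.koopman : L2 μ → L2 μ)) Pi.topologicalSpace

/-- The weak operator topology of the Koopman operators. -/
abbrev weakTopology (μ : Measure X) : TopologicalSpace (Transformation μ) :=
  TopologicalSpace.induced
    (fun (T : Transformation μ) (p : L2 μ × L2 μ) => inner ℂ p.1 (T.koopman p.2))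
    Pi.topologicalSpace

/-- The set `𝒯_inv` of (essentially) invertible transformations: those with an almost everywhere
two-sided inverse which is measure preserving. -/
def invertible (μ : Measure X) : Set (Transformation μ) :=
  {T | ∃ (f g : X → X) (hf : MeasurePreserving f μ μ) (_ : MeasurePreserving g μ μ),
    T = mk f hf ∧ g ∘ f =ᵐ[μ] id ∧ f ∘ g =ᵐ[μ] id}

/-- The strong* operator topology on `𝒯_inv`: pointwise norm convergence of the Koopman operators
and of their adjoints. -/
abbrev strongStarTopology (μ : Measure X) : TopologicalSpace (invertible μ) :=
  TopologicalSpace.induced (fun T => (T.1.koopman : L2 μ → L2 μ)) Pi.topologicalSpace ⊓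
  TopologicalSpace.induced
    (fun T => (ContinuousLinearMap.adjoint T.1.koopman : L2 μ → L2 μ)) Pi.topologicalSpace

end Transformation

end

/-! Koopman operators are isometries, so weak convergence of images of a vector is norm convergence;
on invertible transformations the adjoints are isometric too, which gives the strong* claim.
Invertibility means that the Koopman range contains one fixed injective `φ ∈ L²`. As the range is
closed, this says that `φ` has distance zero from it, a Gδ condition. For density, `f` is tested on
finitely many simple functions, that is, on a partition into sets `A i`. Since `f⁻¹(A i)` and `A i`
have equal mass and atomless spaces of equal mass are isomorphic, an invertible map can carry the
one onto the other. Genericity then passes up from a dense residual subspace. -/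

/-! ### Isomorphism of atomless standard measure spaces -/

theorem measure_le_of_forall_isCompact_le {ν : Measure ℝ} [IsFiniteMeasure ν] {s : Set ℝ}
    (hs : MeasurableSet s) {c : ℝ≥0∞}
    (h : ∀ K ⊆ s, IsCompact K → K.Nonempty → ν K ≤ c) : ν s ≤ c := by
  by_contra! hc
  obtain ⟨K, hKs, hK, hlt⟩ := hs.exists_lt_isCompact hc
  rcases K.eq_empty_or_nonempty with rfl | hne
  · simp at hlt
  · exact absurd (h K hKs hK hne) hlt.not_ge

theorem monotone_real_Iic (ν : Measure ℝ) [IsFiniteMeasure ν] :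
    Monotone fun x => ν.real (Set.Iic x) :=
  fun _ _ h => measureReal_mono (Set.Iic_subset_Iic.2 h)

/-- By inner regularity only compact subsets matter, and these attain their maximum or minimum,
where the distribution function obeys the bound. No continuity of it is needed. -/
theorem measure_setOf_real_Iic_le (ν : Measure ℝ) [IsFiniteMeasure ν] [NullSingletonClass ν]
    {t : ℝ} (ht : t ≤ ν.real Set.univ) :
    ν {x | ν.real (Set.Iic x) ≤ t} = ENNReal.ofReal t := by
  have hm : MeasurableSet {x | ν.real (Set.Iic x) ≤ t} :=
    measurableSet_le (monotone_real_Iic ν).measurable measurable_const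
  apply le_antisymm
  · refine measure_le_of_forall_isCompact_le hm fun K hKs hK hne => ?_
    obtain ⟨x, hx, hmax⟩ := hK.exists_isGreatest hne
    calc ν K ≤ ν (Set.Iic x) := measure_mono fun y hy => hmax hy
      _ = ENNReal.ofReal (ν.real (Set.Iic x)) := by simp
      _ ≤ _ := ENNReal.ofReal_le_ofReal (hKs hx)
  · have hc : ν {x | ν.real (Set.Iic x) ≤ t}ᶜ ≤ ENNReal.ofReal (ν.real Set.univ - t) := by
      refine measure_le_of_forall_isCompact_le hm.compl fun K hKs hK hne => ?_
      obtain ⟨x, hx, hmin⟩ := hK.exists_isLeast hne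
      calc ν K ≤ ν (Set.Ici x) := measure_mono fun y hy => hmin hy
        _ = ν (Set.Iic x)ᶜ := by rw [Set.compl_Iic, measure_congr Ioi_ae_eq_Ici]
        _ = ENNReal.ofReal (ν.real (Set.Iic x)ᶜ) := by simp
        _ ≤ _ := by
          apply ENNReal.ofReal_le_ofReal
          rw [measureReal_compl measurableSet_Iic]
          have : t < ν.real (Set.Iic x) := not_le.1 (hKs hx)
          linarith
    have hc' : ν.real {x | ν.real (Set.Iic x) ≤ t}ᶜ ≤ ν.real Set.univ - t :=
      ENNReal.toReal_le_of_le_ofReal (by linarith) hc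
    rw [measureReal_compl hm] at hc'
    exact ENNReal.ofReal_le_of_le_toReal (by change t ≤ ν.real _; linarith)

theorem measure_setOf_lt_and_real_Iic_eq (ν : Measure ℝ) [IsFiniteMeasure ν] (q : ℝ) :
    ν {x | q < x ∧ ν.real (Set.Iic x) = ν.real (Set.Iic q)} = 0 := by
  have hm : MeasurableSet {x | q < x ∧ ν.real (Set.Iic x) = ν.real (Set.Iic q)} :=
    measurableSet_Ioi.inter
      ((monotone_real_Iic ν).measurable (measurableSet_singleton (ν.real (Set.Iic q))))
  refine le_antisymm (measure_le_of_forall_isCompact_le hm fun K hKs hK hne => ?_) zero_le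
  obtain ⟨x, hx, hmax⟩ := hK.exists_isGreatest hne
  have hz : ν.real (Set.Ioc q x) = 0 := by
    have := measureReal_sdiff (μ := ν) (Set.Iic_subset_Iic.2 (hKs hx).1.le) measurableSet_Iic
    rw [(hKs hx).2, sub_self, Set.Iic_sdiff_Iic] at this
    exact this
  calc ν K ≤ ν (Set.Ioc q x) := measure_mono fun y hy => ⟨(hKs hy).1, hmax hy⟩
    _ ≤ 0 := ((measureReal_eq_zero_iff).1 hz).le

/-- An atomless finite measure on a standard Borel space is isomorphic modulo null sets to the
Lebesgue measure on the interval `[0, m]`, where `m` is its mass. -/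
theorem exists_map_eq_volume_restrict {X : Type*} [MeasurableSpace X] [StandardBorelSpace X]
    [Nonempty X] (ν : Measure X) [IsFiniteMeasure ν] [NullSingletonClass ν] :
    ∃ (F : X → ℝ) (G : ℝ → X), Measurable F ∧ Measurable G ∧
      ν.map F = volume.restrict (Set.Icc 0 (ν.real Set.univ)) ∧ G ∘ F =ᵐ[ν] id := by
  have he := measurableEmbedding_embeddingReal X
  set e := embeddingReal X
  set ρ := ν.map e with hρ
  have : NullSingletonClass ρ := ⟨fun x => by
    rw [hρ, he.map_apply]
    exact (Set.subsingleton_singleton.preimage he.injective).measure_zero ν⟩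
  have hmass : ρ.real Set.univ = ν.real Set.univ := by
    simp [Measure.real, hρ, Measure.map_apply he.measurable]
  set F : ℝ → ℝ := fun x => ρ.real (Set.Iic x)
  have hFm : Measurable F := (monotone_real_Iic ρ).measurable
  have hFe : Measurable (F ∘ e) := hFm.comp he.measurable
  -- Two points with equal `F` have a rational between them, which puts the larger one in `N`; so
  -- `F` is injective off this null set.
  set N : Set ℝ := ⋃ q : ℚ, {x | (q : ℝ) < x ∧ F x = F q}
  have hNm : MeasurableSet N := MeasurableSet.iUnion fun q =>
    measurableSet_Ioi.inter (hFm (measurableSet_singleton (F q)))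
  have hN0 : ρ N = 0 := measure_iUnion_null fun q => measure_setOf_lt_and_real_Iic_eq ρ q
  set B : Set X := e ⁻¹' Nᶜ
  have hB : MeasurableSet B := he.measurable hNm.compl
  have hinj : Set.InjOn F Nᶜ := by
    have key : ∀ x y, y ∈ Nᶜ → x < y → F x ≠ F y := fun x y hy hxy h => by
      obtain ⟨q, hxq, hqy⟩ := exists_rat_btwn hxy
      refine hy (Set.mem_iUnion.2 ⟨q, hqy, le_antisymm ?_ (monotone_real_Iic ρ hqy.le)⟩)
      exact h.symm.le.trans (monotone_real_Iic ρ hxq.le)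
    intro x hx y hy h
    rcases lt_trichotomy x y with hlt | heq | hlt
    · exact absurd h (key x y hy hlt)
    · exact heq
    · exact absurd h.symm (key y x hx hlt)
  have := hB.standardBorel
  have hemb : MeasurableEmbedding (fun x : B => F (e x)) :=
    (hFe.comp measurable_subtype_coe).measurableEmbedding fun x y h =>
      Subtype.ext (he.injective (hinj x.2 y.2 h))
  obtain ⟨G, hG, hGF⟩ := hemb.exists_measurable_extend measurable_subtype_coe fun _ => ‹_›
  refine ⟨F ∘ e, G, hFe, hG, ?_, ?_⟩
  · refine Measure.ext_of_Iic _ _ fun t => ?_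
    rw [← Measure.map_map hFm he.measurable, ← hρ, Measure.map_apply hFm measurableSet_Iic,
      Measure.restrict_apply measurableSet_Iic, ← hmass]
    change ρ {x | F x ≤ t} = _
    rcases le_total t (ρ.real Set.univ) with ht | ht
    · have h2 : Set.Iic t ∩ Set.Icc 0 (ρ.real Set.univ) = Set.Icc 0 t := by
        ext x
        simp only [Set.mem_inter_iff, Set.mem_Iic, Set.mem_Icc]
        exact ⟨fun h => ⟨h.2.1, h.1⟩, fun h => ⟨h.2, h.1, h.2.trans ht⟩⟩
      rw [h2, Real.volume_Icc, sub_zero]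
      exact measure_setOf_real_Iic_le ρ ht
    · have h1 : {x | F x ≤ t} = Set.univ :=
        Set.eq_univ_of_forall fun x => (measureReal_mono (Set.subset_univ _)).trans ht
      have h2 : Set.Iic t ∩ Set.Icc 0 (ρ.real Set.univ) = Set.Icc 0 (ρ.real Set.univ) :=
        Set.inter_eq_right.2 fun x hx => hx.2.trans ht
      rw [h1, h2, Real.volume_Icc, sub_zero, ofReal_measureReal]
  · have : ∀ᵐ x ∂ν, x ∈ B := by
      rw [hρ, he.map_apply] at hN0
      filter_upwards [measure_eq_zero_iff_ae_notMem.1 hN0] with x hx using hx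
    filter_upwards [this] with x hx using congrFun hGF ⟨x, hx⟩

/-- Atomless finite measures of equal mass on a standard Borel space are isomorphic modulo
null sets. -/
theorem exists_measurePreserving_ae_leftInverse {X : Type*} [MeasurableSpace X]
    [StandardBorelSpace X] [Nonempty X] (ν₁ ν₂ : Measure X) [IsFiniteMeasure ν₁]
    [IsFiniteMeasure ν₂] [NullSingletonClass ν₁] [NullSingletonClass ν₂]
    (h : ν₁ Set.univ = ν₂ Set.univ) :
    ∃ S R : X → X, MeasurePreserving S ν₁ ν₂ ∧ Measurable R ∧ R ∘ S =ᵐ[ν₁] id := by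
  obtain ⟨F₁, G₁, hF₁, hG₁, hm₁, hi₁⟩ := exists_map_eq_volume_restrict ν₁
  obtain ⟨F₂, G₂, hF₂, hG₂, hm₂, hi₂⟩ := exists_map_eq_volume_restrict ν₂
  have hm : ν₁.map F₁ = ν₂.map F₂ := by rw [hm₁, hm₂, Measure.real, Measure.real, h]
  refine ⟨G₂ ∘ F₁, G₁ ∘ F₂, ⟨hG₂.comp hF₁, ?_⟩, hG₁.comp hF₂, ?_⟩
  · rw [← Measure.map_map hG₂ hF₁, hm, Measure.map_map hG₂ hF₂, Measure.map_congr hi₂,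
      Measure.map_id]
  · have h₂ : ∀ᵐ t ∂ν₂.map F₂, (F₂ ∘ G₂) t = id t := by
      rw [ae_map_iff hF₂.aemeasurable (measurableSet_eq_fun (hF₂.comp hG₂) measurable_id)]
      filter_upwards [hi₂] with x hx using congrArg F₂ hx
    rw [← hm] at h₂
    filter_upwards [ae_of_ae_map hF₁.aemeasurable h₂, hi₁] with x hx hx₁
    simp only [Function.comp_apply] at hx hx₁ ⊢
    rw [hx, id, hx₁, id]

/-- For a measure-preserving map `f` and a countable measurable partition, some measure-preserving
map which is invertible almost everywhere moves the points between the same atoms as `f`. -/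
theorem exists_ae_leftInverse_comp_ae_eq {X ι : Type*} [MeasurableSpace X]
    [StandardBorelSpace X] (μ : Measure X) [IsProbabilityMeasure μ] [NullSingletonClass μ]
    [Countable ι] [MeasurableSpace ι] [MeasurableSingletonClass ι] {q : X → ι}
    (hq : Measurable q) {f : X → X} (hf : MeasurePreserving f μ μ) :
    ∃ S R : X → X, MeasurePreserving S μ μ ∧ Measurable R ∧ R ∘ S =ᵐ[μ] id ∧
      q ∘ S =ᵐ[μ] q ∘ f := by
  have : Nonempty X := nonempty_of_isProbabilityMeasure μ
  have hA : ∀ i, MeasurableSet (q ⁻¹' {i}) := fun i => hq (measurableSet_singleton i)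
  have hfA : ∀ i, MeasurableSet ((q ∘ f) ⁻¹' {i}) := fun i =>
    hq.comp hf.measurable (measurableSet_singleton i)
  have key : ∀ i, ∃ S R : X → X,
      MeasurePreserving S (μ.restrict ((q ∘ f) ⁻¹' {i})) (μ.restrict (q ⁻¹' {i})) ∧
        Measurable R ∧ R ∘ S =ᵐ[μ.restrict ((q ∘ f) ⁻¹' {i})] id := fun i => by
    refine exists_measurePreserving_ae_leftInverse _ _ ?_
    rw [Measure.restrict_apply_univ, Measure.restrict_apply_univ, Set.preimage_comp,
      hf.measure_preimage (hA i).nullMeasurableSet]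
  choose S R hS hR hRS using key
  have hsum : ∀ {p : X → ι}, (∀ i, MeasurableSet (p ⁻¹' {i})) →
      Measure.sum (fun i => μ.restrict (p ⁻¹' {i})) = μ := fun {p} hp => by
    rw [← Measure.restrict_iUnion (fun i j h => Disjoint.preimage p (by simpa using h)) hp,
      ← Set.preimage_iUnion, Set.iUnion_of_singleton, Set.preimage_univ, Measure.restrict_univ]
  have hae : ∀ {p : X → Prop},
      (∀ i, ∀ᵐ x ∂μ.restrict ((q ∘ f) ⁻¹' {i}), p x) → ∀ᵐ x ∂μ, p x := fun {p} hp => by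
    rw [← hsum hfA]
    exact Measure.ae_sum_iff.2 hp
  have hSm : Measurable fun x => S (q (f x)) x :=
    (measurable_from_prod_countable_right (f := fun y : ι × X => S y.1 y.2)
      fun i => (hS i).measurable).comp ((hq.comp hf.measurable).prodMk measurable_id)
  have hRm : Measurable fun x => R (q x) x :=
    (measurable_from_prod_countable_right (f := fun y : ι × X => R y.1 y.2)
      hR).comp (hq.prodMk measurable_id)
  have hSi : ∀ i, (fun x => S (q (f x)) x) =ᵐ[μ.restrict ((q ∘ f) ⁻¹' {i})] S i := fun i => by
    filter_upwards [ae_restrict_mem (hfA i)] with x hx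
    rw [show q (f x) = i from hx]
  have hqS : ∀ i, ∀ᵐ x ∂μ.restrict ((q ∘ f) ⁻¹' {i}), q (S i x) = i := fun i =>
    (hS i).quasiMeasurePreserving.ae (ae_restrict_mem (hA i))
  -- The pieces are glued: `S i` acts on `f⁻¹(A i)` and lands in `A i`, so `q` of the image tells
  -- which `R i` undoes it.
  refine ⟨fun x => S (q (f x)) x, fun x => R (q x) x, ⟨hSm, ?_⟩, hRm,
    hae fun i => ?_, hae fun i => ?_⟩
  · conv_lhs => rw [← hsum hfA]
    rw [Measure.map_sum hSm.aemeasurable]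
    conv_rhs => rw [← hsum hA]
    congr 1
    ext1 i
    rw [Measure.map_congr (hSi i), (hS i).map_eq]
  · filter_upwards [hSi i, hqS i, hRS i] with x h₁ h₂ h₃
    simp only [Function.comp_apply, h₁, h₂] at h₃ ⊢
    exact h₃
  · filter_upwards [hSi i, hqS i, ae_restrict_mem (hfA i)] with x h₁ h₂ h₃
    simp only [Function.comp_apply, h₁, h₂]
    exact h₃.symm

/-! ### Invertible transformations form a dense Gδ -/

namespace Transformation

variable {X : Type*} [MeasurableSpace X] {μ : Measure X}

/-- As `μ` is its own image under `S`, identities need checking only at points `S x`, where `R ∘ S =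
id` settles them. -/
theorem mk_mem_invertible [StandardBorelSpace X] {S R : X → X}
    (hS : MeasurePreserving S μ μ) (hR : Measurable R) (h : R ∘ S =ᵐ[μ] id) :
    mk S hS ∈ invertible μ := by
  refine ⟨S, R, hS, ⟨hR, ?_⟩, rfl, h, ?_⟩
  · conv_lhs => rw [← hS.map_eq]
    rw [Measure.map_map hR hS.measurable, Measure.map_congr h, Measure.map_id]
  · have : ∀ᵐ y ∂μ.map S, (S ∘ R) y = id y := by
      have := measurableSet_eq_fun (hS.measurable.comp hR) measurable_id
      rw [ae_map_iff hS.measurable.aemeasurable this]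
      filter_upwards [h] with x hx using congrArg S hx
    rwa [hS.map_eq] at this

theorem exists_eq_mk (T : Transformation μ) : ∃ f hf, T = mk f hf := by
  obtain ⟨⟨f, hf⟩, rfl⟩ := Quotient.exists_rep T
  exact ⟨f, hf, rfl⟩

theorem norm_koopman (T : Transformation μ) (g : L2 μ) : ‖T.koopman g‖ = ‖g‖ := by
  obtain ⟨f, hf, rfl⟩ := T.exists_eq_mk
  exact Lp.norm_compMeasurePreserving g hf

theorem koopman_coeFn {f : X → X} (hf : MeasurePreserving f μ μ) (g : L2 μ) :
    (mk f hf).koopman g =ᵐ[μ] g ∘ f :=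
  Lp.coeFn_compMeasurePreserving g hf

theorem dense_invertible [StandardBorelSpace X] [IsProbabilityMeasure μ]
    [NullSingletonClass μ] : Dense (invertible μ) := by
  intro T
  obtain ⟨f, hf, rfl⟩ := T.exists_eq_mk
  rw [mem_closure_iff_nhds]
  intro U hU
  rw [nhds_induced, Filter.mem_comap] at hU
  obtain ⟨V, hV, hVU⟩ := hU
  rw [nhds_pi, Filter.mem_pi] at hV
  obtain ⟨I, hI, W, hW, hIV⟩ := hV
  have := hI.to_subtype
  choose ε hε hεW using fun g => Metric.mem_nhds_iff.1 (hW g)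
  have hs : ∀ g : L2 μ, ∃ s : SimpleFunc X ℂ, ∃ hs : MemLp s 2 μ,
      ‖g - hs.toLp s‖ < ε g / 2 := fun g => by
    obtain ⟨s, hlt, hs⟩ := (Lp.memLp g).exists_simpleFunc_eLpNorm_sub_lt (by simp)
      (ENNReal.ofReal_pos.2 (half_pos (hε g))).ne'
    refine ⟨s, hs, ?_⟩
    have hsub : g - hs.toLp s = ((Lp.memLp g).sub hs).toLp (⇑g - ⇑s) := by
      rw [MemLp.toLp_sub (Lp.memLp g), Lp.toLp_coeFn]
    rw [hsub, Lp.norm_toLp]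
    exact ENNReal.toReal_lt_of_lt_ofReal hlt
  choose s hs hlt using hs
  -- `q` records the values of all approximating simple functions at once; maps agreeing after `q`
  -- act alike on each of them.
  let q : X → (i : I) → Set.range (s i) := fun x i => ⟨s i x, x, rfl⟩
  have hq : Measurable q := measurable_pi_lambda _ fun i => (s i).measurable.subtype_mk
  have : ∀ i : I, Finite (Set.range (s i)) := fun i => (s i).finite_range
  obtain ⟨S, R, hS, hR, hRS, hqS⟩ := exists_ae_leftInverse_comp_ae_eq μ hq hf
  refine ⟨mk S hS, hVU (hIV fun g hg => hεW g ?_), mk_mem_invertible hS hR hRS⟩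
  have heq : (mk S hS).koopman ((hs g).toLp (s g)) = (mk f hf).koopman ((hs g).toLp (s g)) := by
    refine Lp.ext ?_
    filter_upwards [koopman_coeFn hS ((hs g).toLp (s g)), koopman_coeFn hf ((hs g).toLp (s g)),
      hS.quasiMeasurePreserving.ae (hs g).coeFn_toLp,
      hf.quasiMeasurePreserving.ae (hs g).coeFn_toLp, hqS] with x h₁ h₂ h₃ h₄ h₅
    rw [h₁, h₂, Function.comp_apply, Function.comp_apply, h₃, h₄]
    exact congrArg Subtype.val (congrFun h₅ ⟨g, hg⟩)
  rw [mem_ball_iff_norm]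
  calc ‖(mk S hS).koopman g - (mk f hf).koopman g‖
      = ‖(mk S hS).koopman (g - (hs g).toLp (s g)) -
          (mk f hf).koopman (g - (hs g).toLp (s g))‖ := by
        rw [map_sub, map_sub, heq, sub_sub_sub_cancel_right]
    _ ≤ _ := norm_sub_le _ _
    _ < ε g := by rw [norm_koopman, norm_koopman]; linarith [hlt g]

theorem exists_memLp_measurableEmbedding (X : Type*) [MeasurableSpace X] [StandardBorelSpace X]
    (μ : Measure X) [IsFiniteMeasure μ] :
    ∃ φ : X → ℂ, MeasurableEmbedding φ ∧ MemLp φ 2 μ := by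
  have he := measurableEmbedding_embeddingReal X
  have hm : Measurable fun x => (Real.arctan (embeddingReal X x) : ℂ) :=
    Complex.measurable_ofReal.comp (Real.measurable_arctan.comp he.measurable)
  refine ⟨_, hm.measurableEmbedding
    (Complex.ofReal_injective.comp (Real.arctan_injective.comp he.injective)), ?_⟩
  refine MemLp.of_bound hm.aestronglyMeasurable (Real.pi / 2) (.of_forall fun x => ?_)
  rw [Complex.norm_real]
  exact abs_le.2 ⟨(Real.neg_pi_div_two_lt_arctan _).le, (Real.arctan_lt_pi_div_two _).le⟩

theorem mem_invertible_of_mem_range_koopman [StandardBorelSpace X] {φ : X → ℂ}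
    (hφ : MeasurableEmbedding φ) (hφ₂ : MemLp φ 2 μ) {T : Transformation μ}
    (h : hφ₂.toLp φ ∈ Set.range T.koopman) : T ∈ invertible μ := by
  obtain ⟨f, hf, rfl⟩ := T.exists_eq_mk
  obtain ⟨ψ, hψ⟩ := h
  rcases isEmpty_or_nonempty X with hX | hX
  · exact mk_mem_invertible hf measurable_id (.of_forall fun x => isEmptyElim x)
  obtain ⟨r, hr, hrφ⟩ := hφ.exists_measurable_extend measurable_id fun _ => hX
  -- From `φ = ψ ∘ f` a.e., the map `φ⁻¹ ∘ ψ` is a left inverse of `f`.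
  refine mk_mem_invertible hf (hr.comp (Lp.stronglyMeasurable ψ).measurable) ?_
  have h₁ := koopman_coeFn hf ψ
  rw [hψ] at h₁
  filter_upwards [h₁, hφ₂.coeFn_toLp] with x hx hx'
  rw [hx'] at hx
  rw [Function.comp_apply, Function.comp_apply, ← Function.comp_apply (f := ψ), ← hx]
  exact congrFun hrφ x

theorem koopman_surjective {T : Transformation μ} (hT : T ∈ invertible μ) :
    Function.Surjective T.koopman := by
  obtain ⟨f, g, hf, hg, rfl, hgf, -⟩ := hT
  intro φ
  refine ⟨(mk g hg).koopman φ, Lp.ext ?_⟩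
  filter_upwards [koopman_coeFn hf ((mk g hg).koopman φ),
    hf.quasiMeasurePreserving.ae (koopman_coeFn hg φ), hgf] with x h₁ h₂ h₃
  rw [h₁, Function.comp_apply, h₂]
  exact congrArg φ h₃

theorem continuous_koopman_apply (g : L2 μ) :
    Continuous fun T : Transformation μ => T.koopman g :=
  (continuous_apply g).comp continuous_induced_dom

theorem isometry_koopman (T : Transformation μ) : Isometry T.koopman :=
  AddMonoidHomClass.isometry_of_norm _ T.norm_koopman

theorem exists_isOpen_iInter_eq_invertible [StandardBorelSpace X] [IsFiniteMeasure μ] :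
    ∃ U : ℕ → Set (Transformation μ), (∀ n, IsOpen (U n)) ∧ invertible μ = ⋂ n, U n := by
  obtain ⟨φ, hφ, hφ₂⟩ := exists_memLp_measurableEmbedding X μ
  refine ⟨fun n => ⋃ g : L2 μ, {T | dist (hφ₂.toLp φ) (T.koopman g) < 1 / ((n : ℝ) + 1)},
    fun n => isOpen_iUnion fun g =>
      isOpen_lt (continuous_const.dist (continuous_koopman_apply g)) continuous_const, ?_⟩
  ext T
  simp only [Set.mem_iInter, Set.mem_iUnion, Set.mem_ofPred_eq]
  constructor
  · intro hT n
    obtain ⟨g, hg⟩ := koopman_surjective hT (hφ₂.toLp φ)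
    refine ⟨g, ?_⟩
    rw [hg, dist_self]
    positivity
  · intro h
    refine mem_invertible_of_mem_range_koopman hφ hφ₂ ?_
    rw [← T.isometry_koopman.isClosedEmbedding.isClosed_range.closure_eq, Metric.mem_closure_iff]
    intro ε hε
    obtain ⟨n, hn⟩ := exists_nat_one_div_lt hε
    obtain ⟨g, hg⟩ := h n
    exact ⟨_, ⟨g, rfl⟩, hg.trans hn⟩

end Transformation

/-! ### Comparison of topologies and transfer of genericity -/

theorem continuous_of_continuous_inner_of_norm_eq {α H : Type*} [TopologicalSpace α]
    [NormedAddCommGroup H] [InnerProductSpace ℂ H] {u : α → H} {c : ℝ} (hc : ∀ a, ‖u a‖ = c)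
    (h : ∀ v, Continuous fun a => inner ℂ v (u a)) : Continuous u := by
  refine continuous_iff_continuousAt.2 fun a₀ => ?_
  rw [ContinuousAt, tendsto_iff_norm_sub_tendsto_zero]
  have heq : ∀ a, ‖u a - u a₀‖ = √(2 * (c ^ 2 - (inner ℂ (u a₀) (u a)).re)) := fun a => by
    rw [← norm_sub_rev, ← Real.sqrt_sq (norm_nonneg (u a₀ - u a)), norm_sub_sq (𝕜 := ℂ), hc, hc]
    congr 1
    change c ^ 2 - 2 * (inner ℂ (u a₀) (u a)).re + c ^ 2 = _
    ring
  have hcont : Continuous fun a => ‖u a - u a₀‖ := by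
    simp_rw [heq]
    exact (continuous_const.mul
      (continuous_const.sub (Complex.continuous_re.comp (h (u a₀))))).sqrt
  simpa using hcont.tendsto a₀

/-- A dense open subset of `D` is the trace of an open set of `Y`, which is dense because `D` is. -/
theorem mem_residual_of_dense_subtype {Y : Type*} [TopologicalSpace Y] {D s : Set Y}
    (hD : Dense D) (hDr : D ∈ residual Y) (h : {x : D | (x : Y) ∈ s} ∈ residual D) :
    s ∈ residual Y := by
  obtain ⟨S, ho, hd, hS, hsub⟩ := mem_residual_iff.1 h
  have key : ∀ t ∈ S, ∃ V : Set Y, V ∈ residual Y ∧ (↑) ⁻¹' V = t := fun t ht => by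
    obtain ⟨V, hV, rfl⟩ := isOpen_induced_iff.1 (ho t ht)
    refine ⟨V, residual_of_dense_open hV ?_, rfl⟩
    exact (hD.denseRange_val.dense_image continuous_subtype_val (hd _ ht)).mono
      (Set.image_preimage_subset _ _)
  choose! V hV hVt using key
  filter_upwards [hDr, (countable_bInter_mem hS).2 hV] with x hx hxV
  refine hsub (a := ⟨x, hx⟩) fun t ht => ?_
  rw [← hVt t ht]
  exact Set.mem_iInter₂.1 hxV t ht

namespace Transformation

variable {X : Type*} [MeasurableSpace X] {μ : Measure X}

theorem strongTopology_eq_weakTopology :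
    (strongTopology : TopologicalSpace (Transformation μ)) = weakTopology μ := by
  apply le_antisymm
  · refine continuous_iff_le_induced.1 (continuous_pi fun p => ?_)
    exact continuous_const.inner (continuous_koopman_apply p.2)
  · let _ := weakTopology μ
    refine continuous_iff_le_induced.1 (continuous_pi fun g => ?_)
    refine continuous_of_continuous_inner_of_norm_eq (fun T => T.norm_koopman g) fun v => ?_
    have h : Continuous fun (T : Transformation μ) (p : L2 μ × L2 μ) =>
        inner ℂ p.1 (T.koopman p.2) := continuous_induced_dom
    exact continuous_pi_iff.1 h (v, g)

theorem adjoint_koopman_koopman (T : Transformation μ) (g : L2 μ) :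
    ContinuousLinearMap.adjoint T.koopman (T.koopman g) = g :=
  congrArg (fun A : L2 μ →L[ℂ] L2 μ => A g)
    ((ContinuousLinearMap.norm_map_iff_adjoint_comp_self T.koopman).1 T.norm_koopman)

theorem subtype_topology_eq_strongStarTopology :
    (instTopologicalSpaceSubtype : TopologicalSpace (invertible μ)) = strongStarTopology μ := by
  have h : (instTopologicalSpaceSubtype : TopologicalSpace (invertible μ)) =
      TopologicalSpace.induced (fun T => (T.1.koopman : L2 μ → L2 μ)) Pi.topologicalSpace :=
    induced_compose
  rw [strongStarTopology, ← h, eq_comm, inf_eq_left]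
  refine continuous_iff_le_induced.1 (continuous_pi fun g => ?_)
  refine continuous_of_continuous_inner_of_norm_eq (c := ‖g‖) (fun T => ?_) fun v => ?_
  -- Surjectivity makes the adjoint the inverse of an isometry, hence norm-preserving.
  · obtain ⟨k, rfl⟩ := koopman_surjective T.2 g
    rw [adjoint_koopman_koopman, norm_koopman]
  · simp_rw [ContinuousLinearMap.adjoint_inner_right]
    exact ((continuous_koopman_apply v).comp continuous_subtype_val).inner continuous_const

end Transformation

theorem theorem1 {X : Type*} [MeasurableSpace X] [StandardBorelSpace X]
    (μ : Measure X) [IsProbabilityMeasure μ] [NullSingletonClass μ] :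
    -- the strong and the weak operator topology on the set of all transformations coincide
    (Transformation.strongTopology : TopologicalSpace (Transformation μ)) =
      Transformation.weakTopology μ ∧
    -- the invertible transformations are residual
    Transformation.invertible μ ∈ residual (Transformation μ) ∧
    -- they are dense, and the others form a countable union of nowhere dense sets
    Dense (Transformation.invertible μ) ∧
    (∃ M : ℕ → Set (Transformation μ), (∀ n, IsNowhereDense (M n)) ∧
      (Transformation.invertible μ)ᶜ = ⋃ n, M n) ∧
    -- on the invertible transformations, the subspace topology is the strong* topology
    (instTopologicalSpaceSubtype : TopologicalSpace (Transformation.invertible μ)) =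
      Transformation.strongStarTopology μ ∧
    -- every property generic among invertible transformations is generic among all of them
    (∀ P : Transformation μ → Prop,
      {T : Transformation.invertible μ | P T.1} ∈
        @residual (Transformation.invertible μ) (Transformation.strongStarTopology μ) →
      {T : Transformation μ | P T} ∈ residual (Transformation μ)) := by
  obtain ⟨U, hU, hUeq⟩ := Transformation.exists_isOpen_iInter_eq_invertible (μ := μ)
  have hd : Dense (Transformation.invertible μ) := Transformation.dense_invertible
  have hr : Transformation.invertible μ ∈ residual (Transformation μ) :=
    residual_of_dense_Gδ (hUeq ▸ IsGδ.iInter_of_isOpen hU) hd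
  refine ⟨Transformation.strongTopology_eq_weakTopology, hr, hd,
    ⟨fun n => (U n)ᶜ, fun n => ?_, by rw [hUeq, Set.compl_iInter]⟩,
    Transformation.subtype_topology_eq_strongStarTopology, fun P hP => ?_⟩
  · rw [(hU n).isClosed_compl.isNowhereDense_iff, interior_compl, Set.compl_empty_iff,
      ← dense_iff_closure_eq]
    exact hd.mono (hUeq ▸ Set.iInter_subset U n)
  · rw [← Transformation.subtype_topology_eq_strongStarTopology] at hP
    exact mem_residual_of_dense_subtype hd hr hP
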